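/- Let $\rho,\sigma$ be density operators (positive semidefinite, unit trace) on a finite-dimensional complex Hilbert space $\mathcal H$. All logarithms are to base $2$, with $\log 0=-\infty$ for error probabilities. Let $$D(\rho\|\sigma)=\begin{cases}\operatorname{Tr}\rho(\log\rho-\log\sigma), & \operatorname{supp}\rho\subseteq\operatorname{supp}\sigma,\\ +\infty, & \text{otherwise,}\end{cases}$$ be the quantum relative entropy, where the operator logarithms are taken on the supports. A test on $\mathcal H^{\otimes n}$ is an operator $\Pi_n$ with $0\le\Pi_n\le I_n$. Say that $R\in\mathbb R$ has the strong converse property if every sequence of tests $(\Pi_n)_{n\in\mathbb N}$ with $$\limsup_{n\to\infty}\frac1n\log\operatorname{Tr}\Pi_n\sigma^{\otimes n}\le -R$$ satisfies $\lim_{n\to\infty}\operatorname{Tr}(I_n-\Pi_n)\rho^{\otimes n}=1$. Let the asymptotic strong converse rate $R_{sc}\in[-\infty,+\infty]$ of the hypothesis testing problem $H_0:\rho$ versus $H_1:\sigma$ be the infimum of all $R\in\mathbb R$ with this property ($+\infty$ if there is none). Then $$R_{sc}=D(\rho\|\sigma),$$ and every real $R>D(\rho\|\sigma)$ has the strong converse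 property. -/

import Mathlib

open Filter Topology
open scoped Matrix ComplexOrder

noncomputable section

namespace QHT

/-- Density operators on the Hilbert space with orthonormal basis `ι`: positive semidefinite
operators of unit trace. -/
def IsState {ι : Type*} [Fintype ι] (ρ : Matrix ι ι ℂ) : Prop :=
  ρ.PosSemidef ∧ ρ.trace = 1

/-- A test, i.e. an operator `P` with `0 ≤ P ≤ I`; it represents the POVM `{P, I - P}`. -/
def IsTest {ι : Type*} [Fintype ι] [DecidableEq ι] (P : Matrix ι ι ℂ) : Prop :=
  P.PosSemidef ∧ (1 - P).PosSemidef

/-- The `n`-fold tensor power of an operator, in the product basis `Fin n → ι`. -/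
def tensorPow {ι : Type*} (A : Matrix ι ι ℂ) (n : ℕ) :
    Matrix (Fin n → ι) (Fin n → ι) ℂ :=
  Matrix.of fun i j => ∏ k, A (i k) (j k)

/-- The type I error `Tr (I - P) ρ` of the test `P`. -/
def typeI {ι : Type*} [Fintype ι] [DecidableEq ι] (P ρ : Matrix ι ι ℂ) : ℝ :=
  ((1 - P) * ρ).trace.re

/-- The type II error `Tr P σ` of the test `P`. -/
def typeII {ι : Type*} [Fintype ι] (P σ : Matrix ι ι ℂ) : ℝ :=
  (P * σ).trace.re

/-- The support of a positive semidefinite operator, i.e. its range. -/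
def supp {ι : Type*} [Fintype ι] (A : Matrix ι ι ℂ) : Submodule ℂ (ι → ℂ) :=
  LinearMap.range A.mulVecLin

open scoped Classical in
/-- The quantum relative entropy `D(ρ‖σ)`, with logarithms to base `2`: it is
`Tr ρ (log ρ - log σ)` if `supp ρ ⊆ supp σ` and `+∞` otherwise. The logarithms are given by the
functional calculus, with `log` taken to be `0` at the eigenvalue `0`, that is, they are taken
on the supports. -/
def relEntropy {ι : Type*} [Fintype ι] [DecidableEq ι] (ρ σ : Matrix ι ι ℂ) : EReal :=
  if supp ρ ≤ supp σ then
    (((ρ * (cfc (Real.logb 2) ρ - cfc (Real.logb 2) σ)).trace.re : ℝ) : EReal)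
  else ⊤

/-- The base `2` logarithm of a nonnegative number, with `log 0 = -∞`. -/
def log2 (x : ℝ) : EReal :=
  if x ≤ 0 then ⊥ else ((Real.logb 2 x : ℝ) : EReal)

/-- The number `R` has the strong converse property: every sequence of tests whose type II errors
satisfy `limsup (1/n) log Tr (P n) σ^{⊗n} ≤ -R` has type I errors converging to one. -/
def IsStrongConverse {ι : Type*} [Fintype ι] [DecidableEq ι] (ρ σ : Matrix ι ι ℂ) (R : ℝ) :
    Prop :=
  ∀ P : (n : ℕ) → Matrix (Fin n → ι) (Fin n → ι) ℂ, (∀ n, IsTest (P n)) →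
    limsup (fun n : ℕ => (((1 / n : ℝ)) : EReal) * log2 (typeII (P n) (tensorPow σ n))) atTop
      ≤ ((-R : ℝ) : EReal) →
    Tendsto (fun n : ℕ => typeI (P n) (tensorPow ρ n)) atTop (𝓝 1)

/-- The asymptotic strong converse rate: the infimum, in the extended reals, of the numbers with
the strong converse property (`+∞` if there are none). -/
def strongConverseRate {ι : Type*} [Fintype ι] [DecidableEq ι] (ρ σ : Matrix ι ι ℂ) : EReal :=
  sInf ((fun R : ℝ => (R : EReal)) '' {R : ℝ | IsStrongConverse ρ σ R})

end QHT

end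

noncomputable section

set_option linter.unusedSectionVars false

/-! Everything reduces to two classical i.i.d. laws. Diagonalise `ρ` with eigenvalues `r` and `σ`
with eigenvalues `s`, and let `w` be the distribution of measuring `ρ` in the eigenbasis of `σ`;
then D = ∑ r log r - ∑ w log s. By Chebyshev (`tendsto_sum_typical`), `ρ^{⊗n}` lies almost entirely
on the `r`-typical eigenvectors of `ρ^{⊗n}`, with projector F, and also on the `w`-typical
eigenvectors of `σ^{⊗n}`, with projector E.

E and F need not commute. The pinching inequality P ≤ 2(EPE + (1-E)P(1-E)) gets around this at the
price of a factor 2. For the converse (`trace_mul_tensorPow_le`), truncated `ρ^{⊗n}` is at most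
2^{n(∑ r log r + δ)} and E ≤ 2^{n(δ - ∑ w log s)} `σ^{⊗n}`, so the success probability of P is at
most 2 · 2^{n(D+2δ)} Tr P `σ^{⊗n}` + o(1), which vanishes when R > D. For R < D, the tests EFE have
type II error at most 2^{-nR} and keep a fixed success probability; this already refutes the strong
converse property (`not_isStrongConverse_of_lt`). If the support condition fails, a test with zero
type II error refutes every R. -/

namespace QHT

/-! ### Trace inequalities and pinching. -/

section Traces

variable {κ : Type*} [Fintype κ]

lemma trace_mul_re_nonneg {A B : Matrix κ κ ℂ} (hA : A.PosSemidef) (hB : B.PosSemidef) :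
    0 ≤ (A * B).trace.re := by
  classical
  obtain ⟨C, rfl⟩ : ∃ C : Matrix κ κ ℂ, A = Cᴴ * C := by
    open scoped MatrixOrder in
    obtain ⟨C, hC⟩ := CStarAlgebra.nonneg_iff_eq_star_mul_self.mp hA.nonneg
    exact ⟨C, hC⟩
  rw [Matrix.mul_assoc, Matrix.trace_mul_comm]
  exact (Complex.nonneg_iff.mp (hB.mul_mul_conjTranspose_same C).trace_nonneg).1

lemma trace_mul_re_mono_right {A B C : Matrix κ κ ℂ} (hA : A.PosSemidef)
    (h : (C - B).PosSemidef) : (A * B).trace.re ≤ (A * C).trace.re := by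
  have := trace_mul_re_nonneg hA h
  rw [Matrix.mul_sub, Matrix.trace_sub, Complex.sub_re] at this
  linarith

lemma trace_mul_re_mono_left {A B C : Matrix κ κ ℂ} (hA : A.PosSemidef)
    (h : (C - B).PosSemidef) : (B * A).trace.re ≤ (C * A).trace.re := by
  rw [Matrix.trace_mul_comm B, Matrix.trace_mul_comm C]
  exact trace_mul_re_mono_right hA h

variable [DecidableEq κ]

/-- The pinching inequality `P ≤ 2 (E P E + (1 - E) P (1 - E))`. -/
lemma posSemidef_pinching {E P : Matrix κ κ ℂ} (hE : E.IsHermitian) (hP : P.PosSemidef) :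
    ((2 : ℝ) • (E * P * E + (1 - E) * P * (1 - E)) - P).PosSemidef := by
  -- The difference is exactly (2E - 1) P (2E - 1), so E need not be idempotent.
  have h := hP.mul_mul_conjTranspose_same ((2 : ℝ) • E - 1)
  have hH : ((2 : ℝ) • E - 1)ᴴ = (2 : ℝ) • E - 1 := by
    simp [Matrix.conjTranspose_sub, Matrix.conjTranspose_smul, hE.eq]
  rw [hH] at h
  convert h using 1
  simp only [two_smul]
  noncomm_ring

lemma trace_mul_re_pinching {E P X : Matrix κ κ ℂ} (hE : E.IsHermitian) (hP : P.PosSemidef)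
    (hX : X.PosSemidef) :
    (P * X).trace.re ≤
      2 * (E * P * E * X).trace.re + 2 * ((1 - E) * P * (1 - E) * X).trace.re := by
  have h := trace_mul_re_mono_left hX (posSemidef_pinching hE hP)
  rw [Matrix.smul_mul, Matrix.add_mul, Matrix.trace_smul, Matrix.trace_add,
    Complex.smul_re, Complex.add_re, smul_eq_mul] at h
  linarith

end Traces

/-! ### Operators diagonal in a fixed orthonormal basis, spectral projectors. -/

section ConjDiag

variable {κ : Type*} [Fintype κ] [DecidableEq κ]

/-- The operator `U diag(a) U*`. -/
def conjDiag (U : Matrix κ κ ℂ) (a : κ → ℝ) : Matrix κ κ ℂ :=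
  U * Matrix.diagonal (fun i => (a i : ℂ)) * Uᴴ

variable {U : Matrix κ κ ℂ}

lemma conjDiag_mul (hU : Uᴴ * U = 1) (a b : κ → ℝ) :
    conjDiag U a * conjDiag U b = conjDiag U (fun i => a i * b i) := by
  unfold conjDiag
  calc _ = U * Matrix.diagonal (fun i => (a i : ℂ)) * (Uᴴ * U) *
        Matrix.diagonal (fun i => (b i : ℂ)) * Uᴴ := by simp only [Matrix.mul_assoc]
    _ = _ := by
      rw [hU, Matrix.mul_one, Matrix.mul_assoc U, Matrix.diagonal_mul_diagonal]
      simp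

lemma conjDiag_const (hU : Uᴴ * U = 1) (c : ℝ) :
    conjDiag U (fun _ => c) = c • (1 : Matrix κ κ ℂ) := by
  have : Matrix.diagonal (fun _ : κ => (c : ℂ)) = c • (1 : Matrix κ κ ℂ) := by
    ext i j
    by_cases h : i = j <;> simp [h]
  rw [conjDiag, this, Matrix.mul_smul, Matrix.smul_mul, Matrix.mul_one,
    mul_eq_one_comm.mp hU]

lemma conjDiag_one (hU : Uᴴ * U = 1) : conjDiag U (fun _ => 1) = 1 := by
  rw [conjDiag_const hU, one_smul]

lemma conjDiag_sub (a b : κ → ℝ) :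
    conjDiag U a - conjDiag U b = conjDiag U (fun i => a i - b i) := by
  simp only [conjDiag, ← Matrix.sub_mul, ← Matrix.mul_sub, Matrix.diagonal_sub, Complex.ofReal_sub]

lemma posSemidef_conjDiag {a : κ → ℝ} (ha : ∀ i, 0 ≤ a i) : (conjDiag U a).PosSemidef :=
  (Matrix.PosSemidef.diagonal (by intro i; simpa using ha i)).mul_mul_conjTranspose_same U

lemma posSemidef_conjDiag_sub {a b : κ → ℝ} (h : ∀ i, a i ≤ b i) :
    (conjDiag U b - conjDiag U a).PosSemidef := by
  rw [conjDiag_sub]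
  exact posSemidef_conjDiag fun i => sub_nonneg.mpr (h i)

lemma trace_conjDiag_mul (a : κ → ℝ) (B : Matrix κ κ ℂ) :
    (conjDiag U a * B).trace.re = ∑ i, a i * ((Uᴴ * B * U) i i).re := by
  rw [conjDiag, Matrix.mul_assoc, Matrix.mul_assoc, Matrix.trace_mul_comm, Matrix.mul_assoc,
    Matrix.trace, Complex.re_sum]
  refine Finset.sum_congr rfl fun i _ => ?_
  rw [Matrix.diag_apply, Matrix.diagonal_mul, Complex.re_ofReal_mul]

lemma conjTranspose_mul_conjDiag_mul (hU : Uᴴ * U = 1) (a : κ → ℝ) :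
    Uᴴ * conjDiag U a * U = Matrix.diagonal (fun i => (a i : ℂ)) := by
  rw [conjDiag, ← Matrix.mul_assoc, ← Matrix.mul_assoc, hU, Matrix.one_mul, Matrix.mul_assoc, hU,
    Matrix.mul_one]

lemma trace_conjDiag (hU : Uᴴ * U = 1) (a : κ → ℝ) : (conjDiag U a).trace.re = ∑ i, a i := by
  have := trace_conjDiag_mul (U := U) a 1
  rwa [Matrix.mul_one, Matrix.mul_one, hU, Finset.sum_congr rfl fun i _ => by
    rw [Matrix.one_apply_eq, Complex.one_re, mul_one]] at this

/-- The indicator function of a finite set, real valued. -/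
def ind (S : Finset κ) (i : κ) : ℝ := if i ∈ S then 1 else 0

lemma ind_nonneg (S : Finset κ) (i : κ) : 0 ≤ ind S i := by unfold ind; split <;> norm_num

lemma ind_le_one (S : Finset κ) (i : κ) : ind S i ≤ 1 := by unfold ind; split <;> norm_num

lemma ind_mul_self (S : Finset κ) (i : κ) : ind S i * ind S i = ind S i := by
  unfold ind; split <;> norm_num

lemma sum_ind_mul (S : Finset κ) (a : κ → ℝ) : ∑ i, ind S i * a i = ∑ i ∈ S, a i := by
  simp [ind, Finset.sum_ite_mem]

/-- The spectral projector `U diag(a) U*`, with `a` the indicator function of `S`. -/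
def proj (U : Matrix κ κ ℂ) (S : Finset κ) : Matrix κ κ ℂ := conjDiag U (ind S)

lemma posSemidef_proj (S : Finset κ) : (proj U S).PosSemidef :=
  posSemidef_conjDiag (ind_nonneg S)

lemma proj_mul_self (hU : Uᴴ * U = 1) (S : Finset κ) : proj U S * proj U S = proj U S := by
  rw [proj, conjDiag_mul hU]
  simp only [ind_mul_self]

lemma posSemidef_one_sub_proj (hU : Uᴴ * U = 1) (S : Finset κ) :
    (1 - proj U S).PosSemidef := by
  rw [← conjDiag_one hU]
  exact posSemidef_conjDiag_sub (ind_le_one S)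

lemma isTest_proj (hU : Uᴴ * U = 1) (S : Finset κ) : IsTest (proj U S) :=
  ⟨posSemidef_proj S, posSemidef_one_sub_proj hU S⟩

lemma trace_proj_mul (S : Finset κ) (B : Matrix κ κ ℂ) :
    (proj U S * B).trace.re = ∑ i ∈ S, ((Uᴴ * B * U) i i).re := by
  rw [proj, trace_conjDiag_mul, sum_ind_mul]

lemma trace_proj (hU : Uᴴ * U = 1) (S : Finset κ) : (proj U S).trace.re = S.card := by
  rw [proj, trace_conjDiag hU]
  simpa using sum_ind_mul S (fun _ => 1)

/-- Compressing a test by a projector gives a test. -/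
lemma isTest_compression {E F : Matrix κ κ ℂ} (hE : IsTest E) (hEE : E * E = E) (hF : IsTest F) :
    IsTest (E * F * E) := by
  have hH := hE.1.isHermitian.eq
  have h1 := hF.1.mul_mul_conjTranspose_same E
  have h2 := hF.2.mul_mul_conjTranspose_same E
  rw [hH] at h1 h2
  refine ⟨h1, ?_⟩
  have : 1 - E * F * E = (1 - E) + E * (1 - F) * E := by
    rw [Matrix.mul_sub, Matrix.sub_mul, Matrix.mul_one, hEE]
    abel
  rw [this]
  exact hE.2.add h2

/-- The compression by `1 - E` of a test is dominated by `1 - E`. -/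
lemma posSemidef_sub_compl_compression {E F : Matrix κ κ ℂ} (hE : E.IsHermitian)
    (hEE : E * E = E) (hF : IsTest F) :
    ((1 - E) - (1 - E) * F * (1 - E)).PosSemidef := by
  have h2 := hF.2.mul_mul_conjTranspose_same (1 - E)
  rw [Matrix.conjTranspose_sub, Matrix.conjTranspose_one, hE.eq] at h2
  convert h2 using 1
  have h3 : (1 - E) * (1 - E) = 1 - E := by
    rw [Matrix.mul_sub, Matrix.mul_one, Matrix.sub_mul, hEE]; simp
  rw [Matrix.mul_sub (1 - E) 1 F, Matrix.mul_one, Matrix.sub_mul (1 - E), h3]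

end ConjDiag

/-- The spectral theorem together with the functional calculus. -/
lemma exists_conjDiag {ι : Type*} [Fintype ι] [DecidableEq ι] {A : Matrix ι ι ℂ}
    (hA : A.PosSemidef) :
    ∃ (U : Matrix ι ι ℂ) (r : ι → ℝ), Uᴴ * U = 1 ∧ (∀ i, 0 ≤ r i) ∧ A = conjDiag U r ∧
      ∀ f : ℝ → ℝ, cfc f A = conjDiag U (fun i => f (r i)) := by
  have hH := hA.isHermitian
  refine ⟨hH.eigenvectorUnitary, hH.eigenvalues, ?_, hA.eigenvalues_nonneg, ?_, fun f => ?_⟩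
  · exact Unitary.coe_star_mul_self hH.eigenvectorUnitary
  · conv_lhs => rw [hH.spectral_theorem]
    rfl
  · rw [hH.cfc_eq]
    rfl

/-! ### Tensor powers and product measurement distributions. -/

section Tensor

variable {ι : Type*} [Fintype ι] [DecidableEq ι]

lemma tensorPow_mul (A B : Matrix ι ι ℂ) (n : ℕ) :
    tensorPow (A * B) n = tensorPow A n * tensorPow B n := by
  ext I J
  simp only [tensorPow, Matrix.of_apply, Matrix.mul_apply, ← Finset.prod_mul_distrib]
  rw [Finset.prod_univ_sum, Fintype.piFinset_univ]

lemma tensorPow_diagonal (a : ι → ℂ) (n : ℕ) :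
    tensorPow (Matrix.diagonal a) n = Matrix.diagonal (fun I : Fin n → ι => ∏ k, a (I k)) := by
  ext I J
  by_cases h : I = J
  · subst h
    simp [tensorPow]
  · obtain ⟨k, hk⟩ := Function.ne_iff.mp h
    rw [Matrix.diagonal_apply_ne _ h]
    exact Finset.prod_eq_zero (Finset.mem_univ k) (Matrix.diagonal_apply_ne _ hk)

lemma tensorPow_one (n : ℕ) : tensorPow (1 : Matrix ι ι ℂ) n = 1 := by
  rw [← Matrix.diagonal_one, tensorPow_diagonal]
  simp

lemma tensorPow_conjTranspose (A : Matrix ι ι ℂ) (n : ℕ) :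
    tensorPow Aᴴ n = (tensorPow A n)ᴴ := by
  ext I J
  simp [tensorPow]

lemma tensorPow_conjDiag (U : Matrix ι ι ℂ) (a : ι → ℝ) (n : ℕ) :
    tensorPow (conjDiag U a) n =
      conjDiag (tensorPow U n) (fun I : Fin n → ι => ∏ k, a (I k)) := by
  simp only [conjDiag, tensorPow_mul, tensorPow_diagonal, tensorPow_conjTranspose,
    Complex.ofReal_prod]

lemma tensorPow_isometry {U : Matrix ι ι ℂ} (hU : Uᴴ * U = 1) (n : ℕ) :
    (tensorPow U n)ᴴ * tensorPow U n = 1 := by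
  rw [← tensorPow_conjTranspose, ← tensorPow_mul, hU, tensorPow_one]

lemma posSemidef_tensorPow {A : Matrix ι ι ℂ} (hA : A.PosSemidef) (n : ℕ) :
    (tensorPow A n).PosSemidef := by
  obtain ⟨U, r, -, hr, rfl, -⟩ := exists_conjDiag hA
  rw [tensorPow_conjDiag]
  exact posSemidef_conjDiag fun I => Finset.prod_nonneg fun k _ => hr _

lemma trace_tensorPow (A : Matrix ι ι ℂ) (n : ℕ) : (tensorPow A n).trace = A.trace ^ n := by
  simp only [Matrix.trace, Matrix.diag_apply, tensorPow, Matrix.of_apply]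
  rw [← Fin.prod_const, Finset.prod_univ_sum, Fintype.piFinset_univ]

/-- The outcome distribution of measuring `A` in the basis `U`. -/
def diagWeight (U A : Matrix ι ι ℂ) (i : ι) : ℝ := ((Uᴴ * A * U) i i).re

lemma diagWeight_nonneg {A : Matrix ι ι ℂ} (hA : A.PosSemidef) (U : Matrix ι ι ℂ) (i : ι) :
    0 ≤ diagWeight U A i :=
  (Complex.nonneg_iff.mp (hA.conjTranspose_mul_mul_same U).diag_nonneg).1

lemma ofReal_diagWeight {A : Matrix ι ι ℂ} (hA : A.PosSemidef) (U : Matrix ι ι ℂ) (i : ι) :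
    (diagWeight U A i : ℂ) = (Uᴴ * A * U) i i := by
  have h := (Complex.nonneg_iff.mp ((hA.conjTranspose_mul_mul_same U).diag_nonneg (i := i))).2
  exact Complex.ext rfl (by simpa using h)

lemma sum_diagWeight {U A : Matrix ι ι ℂ} (hU : Uᴴ * U = 1) (hA : A.trace = 1) :
    ∑ i, diagWeight U A i = 1 := by
  have : (Uᴴ * A * U).trace = 1 := by
    rw [Matrix.trace_mul_comm, ← Matrix.mul_assoc, mul_eq_one_comm.mp hU, Matrix.one_mul, hA]
  simpa [Matrix.trace, diagWeight] using congrArg Complex.re this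

lemma diagWeight_conjDiag {U : Matrix ι ι ℂ} (hU : Uᴴ * U = 1) (r : ι → ℝ) :
    diagWeight U (conjDiag U r) = r := by
  ext i
  simp [diagWeight, conjTranspose_mul_conjDiag_mul hU]

/-- Diagonal entries of a tensor power are products, so measuring `A^{⊗n}` in the product basis
gives i.i.d. outcomes. -/
lemma trace_proj_mul_tensorPow {A : Matrix ι ι ℂ} (hA : A.PosSemidef) (U : Matrix ι ι ℂ) (n : ℕ)
    (S : Finset (Fin n → ι)) :
    (proj (tensorPow U n) S * tensorPow A n).trace.re =
      ∑ I ∈ S, ∏ k, diagWeight U A (I k) := by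
  rw [trace_proj_mul]
  refine Finset.sum_congr rfl fun I _ => ?_
  rw [← tensorPow_conjTranspose, ← tensorPow_mul, ← tensorPow_mul, tensorPow, Matrix.of_apply]
  simp_rw [← ofReal_diagWeight hA]
  rw [← Complex.ofReal_prod, Complex.ofReal_re]

end Tensor

/-! ### Typical sequences and the weak law of large numbers. -/

section Typical

variable {ι : Type*} [Fintype ι]

lemma sum_prod_eq_pow (w : ι → ℝ) (n : ℕ) :
    ∑ I : Fin n → ι, ∏ k, w (I k) = (∑ i, w i) ^ n := by
  classical
  rw [← Fin.prod_const, Finset.prod_univ_sum, Fintype.piFinset_univ]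

/-- Additivity of variance: splitting off the first letter, the cross term vanishes because `h` is
centred. -/
lemma sum_prod_mul_sq {w h : ι → ℝ} (hw : ∑ i, w i = 1) (hh : ∑ i, w i * h i = 0) (n : ℕ) :
    ∑ I : Fin n → ι, (∏ k, w (I k)) * (∑ k, h (I k)) ^ 2 = n * ∑ i, w i * h i ^ 2 := by
  induction n with
  | zero => simp
  | succ n ih =>
    rw [← (Fin.consEquiv fun _ : Fin (n + 1) => ι).sum_comp, Fintype.sum_prod_type]
    simp only [Fin.consEquiv, Equiv.coe_fn_mk, Fin.prod_univ_succ, Fin.sum_univ_succ,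
      Fin.cons_zero, Fin.cons_succ]
    have key : ∀ i : ι, ∑ I : Fin n → ι,
        w i * (∏ k, w (I k)) * (h i + ∑ k, h (I k)) ^ 2 =
        w i * h i ^ 2 + (w i * h i) * (2 * ∑ I : Fin n → ι, (∏ k, w (I k)) * ∑ k, h (I k)) +
          w i * (n * ∑ i, w i * h i ^ 2) := by
      intro i
      have h1 := sum_prod_eq_pow w n
      rw [hw, one_pow] at h1
      rw [← ih]
      conv_rhs => rw [← mul_one (w i * h i ^ 2), ← h1]
      simp only [Finset.mul_sum, ← Finset.sum_add_distrib]
      refine Finset.sum_congr rfl fun I _ => ?_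
      simp only [← Finset.mul_sum]
      ring
    rw [Finset.sum_congr rfl fun i _ => key i, Finset.sum_add_distrib, Finset.sum_add_distrib,
      ← Finset.sum_mul, ← Finset.sum_mul, hh, hw]
    push_cast
    ring

open scoped Classical in
/-- Sequences of positive probability whose empirical mean of `g` is within `δ` of its
expectation. -/
def typical (w g : ι → ℝ) (δ : ℝ) (n : ℕ) : Finset (Fin n → ι) :=
  {I | ∏ k, w (I k) ≠ 0 ∧ |∑ k, g (I k) - n * ∑ i, w i * g i| ≤ n * δ}

lemma sum_typical_le_one {w : ι → ℝ} (hw0 : ∀ i, 0 ≤ w i) (hw : ∑ i, w i = 1) {n : ℕ}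
    (S : Finset (Fin n → ι)) : ∑ I ∈ S, ∏ k, w (I k) ≤ 1 := by
  have h := sum_prod_eq_pow w n
  rw [hw, one_pow] at h
  rw [← h]
  exact Finset.sum_le_univ_sum_of_nonneg fun I => Finset.prod_nonneg fun k _ => hw0 _

/-- Chebyshev's inequality: the atypical mass is at most the variance over nδ². -/
lemma tendsto_sum_typical {w : ι → ℝ} (hw0 : ∀ i, 0 ≤ w i) (hw : ∑ i, w i = 1) (g : ι → ℝ)
    {δ : ℝ} (hδ : 0 < δ) :
    Tendsto (fun n : ℕ => ∑ I ∈ typical w g δ n, ∏ k, w (I k)) atTop (𝓝 1) := by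
  classical
  set μ := ∑ i, w i * g i with hμ
  set v := ∑ i, w i * (g i - μ) ^ 2 with hv
  have hh : ∑ i, w i * (g i - μ) = 0 := by
    simp [mul_sub, Finset.sum_sub_distrib, ← Finset.sum_mul, hw, hμ]
  have lower : ∀ n : ℕ, 0 < n → 1 - v / δ ^ 2 / n ≤ ∑ I ∈ typical w g δ n, ∏ k, w (I k) := by
    intro n hn
    have hn' : (0 : ℝ) < n := by exact_mod_cast hn
    have h1 := sum_prod_eq_pow w n
    rw [hw, one_pow, ← Finset.sum_add_sum_compl (typical w g δ n)] at h1
    have h2 : (∑ I ∈ (typical w g δ n)ᶜ, ∏ k, w (I k)) * (n * δ) ^ 2 ≤ n * v := by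
      rw [hv, ← sum_prod_mul_sq hw hh n, Finset.sum_mul]
      refine (Finset.sum_le_sum fun I hI => ?_).trans (Finset.sum_le_univ_sum_of_nonneg fun I =>
        mul_nonneg (Finset.prod_nonneg fun k _ => hw0 _) (sq_nonneg _))
      -- A sequence may be atypical merely by having probability zero; it then contributes nothing.
      by_cases h0 : ∏ k, w (I k) = 0
      · simp [h0]
      · refine mul_le_mul_of_nonneg_left ?_ (Finset.prod_nonneg fun k _ => hw0 _)
        have hI' : n * δ < |∑ k, g (I k) - n * μ| := by
          simpa [typical, h0] using hI
        rw [Finset.sum_sub_distrib, Fin.sum_const, nsmul_eq_mul, ← sq_abs (∑ k, g (I k) - n * μ)]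
        exact pow_le_pow_left₀ (by positivity) hI'.le 2
    have h3 : ∑ I ∈ (typical w g δ n)ᶜ, ∏ k, w (I k) ≤ v / δ ^ 2 / n := by
      rw [div_div, le_div_iff₀ (by positivity)]
      refine le_of_mul_le_mul_right ?_ hn'
      nlinarith [h2]
    linarith
  refine tendsto_of_tendsto_of_tendsto_of_le_of_le' ?_ tendsto_const_nhds
    ((eventually_gt_atTop 0).mono lower)
    (Eventually.of_forall fun n => sum_typical_le_one hw0 hw _)
  have := (tendsto_const_div_atTop_nhds_zero_nat (v / δ ^ 2)).const_sub 1
  simpa using this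

/-- On typical sequences, a product of positive numbers is close to its geometric mean. -/
lemma prod_mem_Icc_of_typical {w s : ι → ℝ} (hs0 : ∀ i, 0 ≤ s i) (hsw : ∀ i, s i = 0 → w i = 0)
    {δ : ℝ} {n : ℕ} {I : Fin n → ι} (hI : I ∈ typical w (fun i => Real.logb 2 (s i)) δ n) :
    ∏ k, s (I k) ∈ Set.Icc ((2 : ℝ) ^ (n * (∑ i, w i * Real.logb 2 (s i) - δ)))
      ((2 : ℝ) ^ (n * (∑ i, w i * Real.logb 2 (s i) + δ))) := by
  simp only [typical, Finset.mem_filter, Finset.mem_univ, true_and, Finset.prod_ne_zero_iff,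
    ne_eq, abs_le] at hI
  -- Excluding null sequences from `typical` matters here: the default value `logb 2 0 = 0` never
  -- enters.
  have hpos : ∀ k, 0 < s (I k) := fun k =>
    (hs0 _).lt_of_ne' fun h => hI.1 k trivial (hsw _ h)
  have : ∏ k, s (I k) = (2 : ℝ) ^ (∑ k, Real.logb 2 (s (I k))) := by
    rw [Real.rpow_sum_of_pos (by norm_num)]
    exact Finset.prod_congr rfl fun k _ =>
      (Real.rpow_logb (by norm_num) (by norm_num) (hpos k)).symm
  rw [this]
  constructor <;> refine Real.rpow_le_rpow_of_exponent_le (by norm_num) ?_ <;>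
    linarith [hI.2.1, hI.2.2]

/-- Each typical sequence has probability at least the reciprocal of the bound, and the total is at
most one. -/
lemma card_typical_le {r : ι → ℝ} (hr0 : ∀ i, 0 ≤ r i) (hr : ∑ i, r i = 1) (δ : ℝ) (n : ℕ) :
    ((typical r (fun i => Real.logb 2 (r i)) δ n).card : ℝ) ≤
      (2 : ℝ) ^ (n * (δ - ∑ i, r i * Real.logb 2 (r i))) := by
  set S := typical r (fun i => Real.logb 2 (r i)) δ n with hS
  have h : (S.card : ℝ) * (2 : ℝ) ^ (n * (∑ i, r i * Real.logb 2 (r i) - δ)) ≤ 1 := by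
    rw [← nsmul_eq_mul]
    refine (Finset.card_nsmul_le_sum S _ _ fun I hI => ?_).trans
      (sum_typical_le_one hr0 hr S)
    exact (prod_mem_Icc_of_typical hr0 (fun _ => id) hI).1
  rw [← le_div_iff₀ (by positivity), one_div, ← Real.rpow_neg (by norm_num)] at h
  rwa [← mul_neg, neg_sub] at h

end Typical

/-! ### Error exponents in the extended reals. -/

section Errors

variable {ι : Type*} [Fintype ι] [DecidableEq ι]

lemma typeI_tensorPow {ρ : Matrix ι ι ℂ} (hρ : ρ.trace = 1) {n : ℕ}
    (P : Matrix (Fin n → ι) (Fin n → ι) ℂ) :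
    typeI P (tensorPow ρ n) = 1 - (P * tensorPow ρ n).trace.re := by
  rw [typeI, Matrix.sub_mul, Matrix.one_mul, Matrix.trace_sub, trace_tensorPow, hρ, one_pow]
  simp

lemma one_div_mul_log2_le {n : ℕ} (hn : 0 < n) {t c : ℝ} (h : t ≤ (2 : ℝ) ^ (n * c)) :
    ((1 / n : ℝ) : EReal) * log2 t ≤ (c : EReal) := by
  have hn' : (0 : ℝ) < n := by exact_mod_cast hn
  unfold log2
  split_ifs with ht
  · rw [EReal.coe_mul_bot_of_pos (by positivity)]
    exact bot_le
  · rw [← EReal.coe_mul, EReal.coe_le_coe_iff, one_div, inv_mul_le_iff₀ hn']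
    exact (Real.logb_le_iff_le_rpow (by norm_num) (not_le.mp ht)).mpr h

lemma le_rpow_of_one_div_mul_log2_lt {n : ℕ} (hn : 0 < n) {t c : ℝ}
    (h : ((1 / n : ℝ) : EReal) * log2 t < (c : EReal)) : t ≤ (2 : ℝ) ^ (n * c) := by
  have hn' : (0 : ℝ) < n := by exact_mod_cast hn
  unfold log2 at h
  split_ifs at h with ht
  · exact ht.trans (by positivity)
  · rw [← EReal.coe_mul, EReal.coe_lt_coe_iff, one_div, inv_mul_lt_iff₀ hn'] at h
    exact (Real.logb_le_iff_le_rpow (by norm_num) (not_le.mp ht)).mp h.le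

/-- A sequence of tests with type II exponent at least `R` and type I errors eventually bounded
away from one refutes the strong converse property of `R`. -/
lemma not_isStrongConverse {ρ σ : Matrix ι ι ℂ} {R c : ℝ} (hc : c < 1)
    {P : (n : ℕ) → Matrix (Fin n → ι) (Fin n → ι) ℂ} (hP : ∀ n, IsTest (P n))
    (hII : ∀ n, typeII (P n) (tensorPow σ n) ≤ (2 : ℝ) ^ (n * (-R)))
    (hI : ∀ᶠ n in atTop, typeI (P n) (tensorPow ρ n) ≤ c) : ¬ IsStrongConverse ρ σ R := by
  intro h
  refine absurd (le_of_tendsto (h P hP ?_) hI) (not_le.mpr hc)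
  -- At n = 0 the factor `1 / n` is 0, so that index is dropped.
  exact limsup_le_of_le (h := (eventually_gt_atTop 0).mono fun n hn =>
    one_div_mul_log2_le hn (hII n))

end Errors

/-! ### The support condition in spectral terms. -/

section Spectral

variable {ι : Type*} [Fintype ι] [DecidableEq ι] {ρ : Matrix ι ι ℂ} {V : Matrix ι ι ℂ}
  {s : ι → ℝ}

/-- A zero diagonal entry of a positive semidefinite matrix forces its whole row and column to
vanish, so weights alone detect the inclusion. -/
lemma supp_le_supp_conjDiag_iff (hρ : ρ.PosSemidef) (hV : Vᴴ * V = 1) :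
    supp ρ ≤ supp (conjDiag V s) ↔ ∀ j, s j = 0 → diagWeight V ρ j = 0 := by
  have hV' : V * Vᴴ = 1 := mul_eq_one_comm.mp hV
  have hpsd := hρ.conjTranspose_mul_mul_same V
  constructor
  · intro h j hj
    have hmem : ρ *ᵥ (V *ᵥ Pi.single j 1) ∈ supp (conjDiag V s) :=
      h ⟨V *ᵥ Pi.single j 1, rfl⟩
    obtain ⟨x, hx⟩ := hmem
    have hx' : conjDiag V s *ᵥ x = ρ *ᵥ (V *ᵥ Pi.single j 1) := hx
    have h1 := congrFun (congrArg (fun y => Vᴴ *ᵥ y) hx') j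
    have h2 : Vᴴ *ᵥ (ρ *ᵥ (V *ᵥ Pi.single j 1)) = (Vᴴ * ρ * V).col j := by
      rw [Matrix.mulVec_mulVec, Matrix.mulVec_mulVec, Matrix.mulVec_single_one]
    have h3 : Vᴴ *ᵥ (conjDiag V s *ᵥ x) = Matrix.diagonal (fun i => (s i : ℂ)) *ᵥ (Vᴴ *ᵥ x) := by
      rw [conjDiag, Matrix.mulVec_mulVec, Matrix.mulVec_mulVec, ← Matrix.mul_assoc,
        ← Matrix.mul_assoc, hV, Matrix.one_mul]
    simp only [h2, h3, Matrix.mulVec_diagonal, hj, Complex.ofReal_zero, zero_mul] at h1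
    rw [diagWeight, ← Matrix.col_apply (A := Vᴴ * ρ * V), ← h1, Complex.zero_re]
  · intro h
    have hrow : ∀ j, s j = 0 → ∀ k, (Vᴴ * ρ * V) j k = 0 := by
      intro j hj k
      have h0 : (Vᴴ * ρ * V) j j = 0 := by rw [← ofReal_diagWeight hρ, h j hj, Complex.ofReal_zero]
      have h1 := (hpsd.dotProduct_mulVec_zero_iff (Pi.single j 1)).mp (by simp [h0])
      have h2 : (Vᴴ * ρ * V) k j = 0 := by simpa using congrFun h1 k
      rw [← hpsd.isHermitian.apply j k, h2, star_zero]
    -- With `0⁻¹ = 0` the inner factor is the pseudoinverse of `conjDiag V s`.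
    have hfac : conjDiag V s * (conjDiag V (fun j => (s j)⁻¹) * ρ) = ρ := by
      rw [← Matrix.mul_assoc, conjDiag_mul hV]
      have : Matrix.diagonal (fun j => ((s j * (s j)⁻¹ : ℝ) : ℂ)) * (Vᴴ * ρ * V) =
          Vᴴ * ρ * V := by
        ext j k
        rw [Matrix.diagonal_mul]
        by_cases hj : s j = 0
        · simp [hrow j hj k]
        · rw [mul_inv_cancel₀ hj, Complex.ofReal_one, one_mul]
      calc conjDiag V (fun j => s j * (s j)⁻¹) * ρ
          = V * (Matrix.diagonal (fun j => ((s j * (s j)⁻¹ : ℝ) : ℂ)) * (Vᴴ * ρ * V)) * Vᴴ := by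
            rw [conjDiag]
            simp only [Matrix.mul_assoc, hV', Matrix.mul_one]
        _ = (V * Vᴴ) * ρ * (V * Vᴴ) := by rw [this]; simp only [Matrix.mul_assoc]
        _ = ρ := by rw [hV', Matrix.one_mul, Matrix.mul_one]
    rintro _ ⟨x, rfl⟩
    refine ⟨(conjDiag V (fun j => (s j)⁻¹) * ρ) *ᵥ x, ?_⟩
    rw [Matrix.mulVecLin_apply, Matrix.mulVecLin_apply, Matrix.mulVec_mulVec, hfac]

lemma trace_mul_conjDiag (a : ι → ℝ) :
    (ρ * conjDiag V a).trace.re = ∑ i, diagWeight V ρ i * a i := by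
  rw [Matrix.trace_mul_comm, trace_conjDiag_mul]
  exact Finset.sum_congr rfl fun i _ => mul_comm _ _

/-- If the support condition fails, no number has the strong converse property. -/
lemma not_isStrongConverse_of_not_supp_le (hρ : IsState ρ) (hV : Vᴴ * V = 1)
    (hσ : (conjDiag V s).PosSemidef) {j : ι} (hj : s j = 0)
    (hw : diagWeight V ρ j ≠ 0) (R : ℝ) : ¬ IsStrongConverse ρ (conjDiag V s) R := by
  set w := diagWeight V ρ with hw_def
  have hw0 := diagWeight_nonneg hρ.1 V
  have hw1 : ∑ i, w i = 1 := sum_diagWeight hV hρ.2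
  have hsplit := Finset.add_sum_erase Finset.univ w (Finset.mem_univ j)
  rw [hw1] at hsplit
  have hpos : 0 < w j := (hw0 j).lt_of_ne' hw
  have herase : 0 ≤ ∑ i ∈ Finset.univ.erase j, w i := Finset.sum_nonneg fun i _ => hw0 i
  -- Accept `ρ` when `j` occurs at least once: impossible under `σ`, while under `ρ` the type I
  -- error is (1 - w j)^n.
  let A : (n : ℕ) → Finset (Fin n → ι) := fun n => Fintype.piFinset fun _ => Finset.univ.erase j
  refine not_isStrongConverse (c := 1 - w j) (by linarith)
    (P := fun n => proj (tensorPow V n) (A n)ᶜ)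
    (fun n => isTest_proj (tensorPow_isometry hV n) _) (fun n => ?_) ?_
  · rw [typeII, trace_proj_mul_tensorPow hσ, diagWeight_conjDiag hV]
    rw [Finset.sum_eq_zero fun I hI => ?_]
    · positivity
    · obtain ⟨k, hk⟩ : ∃ k, I k = j := by simpa [A] using hI
      exact Finset.prod_eq_zero (Finset.mem_univ k) (by rw [hk, hj])
  · refine (eventually_gt_atTop 0).mono fun n hn => ?_
    rw [typeI_tensorPow hρ.2, trace_proj_mul_tensorPow hρ.1]
    have h1 := sum_prod_eq_pow w n
    rw [hw1, one_pow, ← Finset.sum_add_sum_compl (A n), ← Finset.prod_univ_sum,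
      Fin.prod_const] at h1
    have h2 : (∑ i ∈ Finset.univ.erase j, w i) ^ n ≤ ∑ i ∈ Finset.univ.erase j, w i :=
      pow_le_of_le_one herase (by linarith) hn.ne'
    linarith

end Spectral

/-! ### Converse and direct bounds. -/

section Rates

variable {ι : Type*} [Fintype ι] [DecidableEq ι] {U V : Matrix ι ι ℂ} {r s : ι → ℝ}

/-- The success probability of a test under `ρ^{⊗n}` in terms of its type II error and of the
weights of the typical sets. -/
lemma trace_mul_tensorPow_le (hU : Uᴴ * U = 1) (hV : Vᴴ * V = 1) (hr0 : ∀ i, 0 ≤ r i)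
    (hr : ∑ i, r i = 1)
    (hs0 : ∀ i, 0 ≤ s i) (hsw : ∀ j, s j = 0 → diagWeight V (conjDiag U r) j = 0) (δ : ℝ) {n : ℕ}
    {P : Matrix (Fin n → ι) (Fin n → ι) ℂ} (hP : IsTest P) :
    (P * tensorPow (conjDiag U r) n).trace.re ≤
      2 * (2 : ℝ) ^ (n * (∑ i, r i * Real.logb 2 (r i) -
        ∑ i, diagWeight V (conjDiag U r) i * Real.logb 2 (s i) + 2 * δ)) *
          typeII P (tensorPow (conjDiag V s) n) +
      2 * (1 - ∑ I ∈ typical (diagWeight V (conjDiag U r)) (fun i => Real.logb 2 (s i)) δ n,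
        ∏ k, diagWeight V (conjDiag U r) (I k)) +
      (1 - ∑ I ∈ typical r (fun i => Real.logb 2 (r i)) δ n, ∏ k, r (I k)) := by
  classical
  set ρ := conjDiag U r with hρ_def
  set w := diagWeight V ρ with hw_def
  set S := typical r (fun i => Real.logb 2 (r i)) δ n with hS
  set T := typical w (fun i => Real.logb 2 (s i)) δ n with hT
  set μr := ∑ i, r i * Real.logb 2 (r i) with hμr
  set μs := ∑ i, w i * Real.logb 2 (s i) with hμs
  have hUn := tensorPow_isometry hU n
  have hVn := tensorPow_isometry hV n
  have hρ : ρ.PosSemidef := posSemidef_conjDiag hr0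
  have htr : (tensorPow ρ n).trace.re = 1 := by
    rw [hρ_def, tensorPow_conjDiag, trace_conjDiag hUn, sum_prod_eq_pow, hr, one_pow]
  -- `ρ^{⊗n}` truncated to its typical eigenvectors, which bounds its norm.
  set X := conjDiag (tensorPow U n) (fun I => ind S I * ∏ k, r (I k)) with hX
  have hX0 : X.PosSemidef := posSemidef_conjDiag fun I =>
    mul_nonneg (ind_nonneg S I) (Finset.prod_nonneg fun k _ => hr0 _)
  have hXρ : (tensorPow ρ n - X).PosSemidef := by
    rw [hρ_def, tensorPow_conjDiag]
    exact posSemidef_conjDiag_sub fun I =>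
      mul_le_of_le_one_left (Finset.prod_nonneg fun k _ => hr0 _) (ind_le_one S I)
  have hXle : ((2 : ℝ) ^ (n * (μr + δ)) • (1 : Matrix (Fin n → ι) (Fin n → ι) ℂ) -
      X).PosSemidef := by
    rw [← conjDiag_const hUn]
    refine posSemidef_conjDiag_sub fun I => ?_
    by_cases hI : I ∈ S
    · simpa [ind, hI] using (prod_mem_Icc_of_typical hr0 (fun _ => id) hI).2
    · simp only [ind, hI, if_false, zero_mul]; positivity
  set E := proj (tensorPow V n) T with hE_def
  have hE : IsTest E := isTest_proj hVn T
  have hEE : E * E = E := proj_mul_self hVn T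
  have hEσ : ((2 : ℝ) ^ (n * (δ - μs)) • tensorPow (conjDiag V s) n - E).PosSemidef := by
    have : (2 : ℝ) ^ (n * (δ - μs)) • tensorPow (conjDiag V s) n =
        conjDiag (tensorPow V n) (fun I => (2 : ℝ) ^ (n * (δ - μs)) * ∏ k, s (I k)) := by
      rw [← conjDiag_mul hVn, conjDiag_const hVn, Matrix.smul_mul, Matrix.one_mul,
        tensorPow_conjDiag]
    rw [this]
    refine posSemidef_conjDiag_sub fun I => ?_
    by_cases hI : I ∈ T
    · simp only [ind, hI, if_true]
      have h := mul_le_mul_of_nonneg_left (prod_mem_Icc_of_typical hs0 hsw hI).1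
        (by positivity : (0 : ℝ) ≤ (2 : ℝ) ^ (n * (δ - μs)))
      rw [← Real.rpow_add (by norm_num)] at h
      refine le_trans (le_of_eq ?_) h
      rw [← hμs, ← mul_add, sub_add_sub_cancel, sub_self, mul_zero, Real.rpow_zero]
    · simp only [ind, hI, if_false]
      exact mul_nonneg (by positivity) (Finset.prod_nonneg fun k _ => hs0 _)
  have h1 : (P * tensorPow ρ n).trace.re ≤ (P * X).trace.re + (1 - ∑ I ∈ S, ∏ k, r (I k)) := by
    have h := trace_mul_re_mono_left hXρ hP.2
    rw [Matrix.one_mul, Matrix.mul_sub, Matrix.trace_sub, Matrix.trace_sub, Complex.sub_re,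
      Complex.sub_re, htr, hX, trace_conjDiag hUn, sum_ind_mul] at h
    linarith
  have h2 := trace_mul_re_pinching hE.1.isHermitian hP.1 hX0
  have h3 : ((1 - E) * P * (1 - E) * X).trace.re ≤ 1 - ∑ I ∈ T, ∏ k, w (I k) := by
    refine (trace_mul_re_mono_left hX0
      (posSemidef_sub_compl_compression hE.1.isHermitian hEE hP)).trans ?_
    refine (trace_mul_re_mono_right hE.2 hXρ).trans ?_
    rw [Matrix.sub_mul, Matrix.one_mul, Matrix.trace_sub, Complex.sub_re, htr,
      trace_proj_mul_tensorPow hρ]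
  have h4 : (E * P * E * X).trace.re ≤
      (2 : ℝ) ^ (n * (μr - μs + 2 * δ)) * typeII P (tensorPow (conjDiag V s) n) := by
    have hEPE := hP.1.mul_mul_conjTranspose_same E
    rw [hE.1.isHermitian.eq] at hEPE
    have h5 := trace_mul_re_mono_right hEPE hXle
    rw [Matrix.mul_smul, Matrix.mul_one, Matrix.trace_smul, Complex.smul_re, smul_eq_mul,
      Matrix.trace_mul_comm (E * P) E, ← Matrix.mul_assoc, hEE, Matrix.trace_mul_comm E P] at h5
    have h6 := trace_mul_re_mono_right hP.1 hEσ
    rw [Matrix.mul_smul, Matrix.trace_smul, Complex.smul_re, smul_eq_mul] at h6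
    refine h5.trans ((mul_le_mul_of_nonneg_left h6 (by positivity)).trans (le_of_eq ?_))
    rw [← mul_assoc, ← Real.rpow_add (by norm_num), typeII]
    congr 2
    ring
  linarith

/-- The strong converse part of the quantum Stein lemma. -/
lemma isStrongConverse_of_lt (hU : Uᴴ * U = 1) (hV : Vᴴ * V = 1) (hr0 : ∀ i, 0 ≤ r i)
    (hs0 : ∀ i, 0 ≤ s i) (hρ : IsState (conjDiag U r))
    (hsw : ∀ j, s j = 0 → diagWeight V (conjDiag U r) j = 0) {R : ℝ}
    (hR : ∑ i, r i * Real.logb 2 (r i) -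
      ∑ i, diagWeight V (conjDiag U r) i * Real.logb 2 (s i) < R) :
    IsStrongConverse (conjDiag U r) (conjDiag V s) R := by
  intro P hP hlim
  have hr : ∑ i, r i = 1 := by simpa [diagWeight_conjDiag hU] using sum_diagWeight hU hρ.2
  have hw0 := diagWeight_nonneg hρ.1 V
  have hw1 := sum_diagWeight hV hρ.2
  have key := fun (δ : ℝ) (n : ℕ) => trace_mul_tensorPow_le hU hV hr0 hr hs0 hsw δ (hP n)
  set w := diagWeight V (conjDiag U r)
  set D := ∑ i, r i * Real.logb 2 (r i) - ∑ i, w i * Real.logb 2 (s i)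
  -- The exponents D + 2δ and -R + δ then add up to -δ.
  set δ := (R - D) / 4 with hδ_def
  have hδ : 0 < δ := by linarith
  have hII : ∀ᶠ n : ℕ in atTop,
      typeII (P n) (tensorPow (conjDiag V s) n) ≤ (2 : ℝ) ^ (n * (-R + δ)) := by
    have hlt : ((-R : ℝ) : EReal) < ((-R + δ : ℝ) : EReal) :=
      EReal.coe_lt_coe_iff.mpr (by linarith)
    filter_upwards [eventually_lt_of_limsup_lt (hlim.trans_lt hlt), eventually_gt_atTop 0]
      with n hn hn0 using le_rpow_of_one_div_mul_log2_lt hn0 hn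
  have hgeom : Tendsto (fun n : ℕ => 2 * ((2 : ℝ) ^ (-δ)) ^ n) atTop (𝓝 0) := by
    simpa using (tendsto_pow_atTop_nhds_zero_of_lt_one (by positivity)
      (Real.rpow_lt_one_of_one_lt_of_neg (by norm_num) (neg_neg_of_pos hδ))).const_mul (2 : ℝ)
  have hlow := ((hgeom.add (((tendsto_sum_typical hw0 hw1 (fun i => Real.logb 2 (s i)) hδ).const_sub
    1).const_mul 2)).add
      ((tendsto_sum_typical hr0 hr (fun i => Real.logb 2 (r i)) hδ).const_sub 1)).const_sub 1
  rw [sub_self, mul_zero, add_zero, add_zero, sub_zero] at hlow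
  refine tendsto_of_tendsto_of_tendsto_of_le_of_le' hlow tendsto_const_nhds ?_
    (Eventually.of_forall fun n => ?_)
  · filter_upwards [hII] with n hn
    rw [typeI_tensorPow hρ.2]
    have h1 := key δ n
    have h2 : (2 : ℝ) ^ (n * (D + 2 * δ)) * typeII (P n) (tensorPow (conjDiag V s) n) ≤
        ((2 : ℝ) ^ (-δ)) ^ n := by
      refine (mul_le_mul_of_nonneg_left hn (by positivity)).trans (le_of_eq ?_)
      rw [← Real.rpow_add (by norm_num), ← Real.rpow_natCast, ← Real.rpow_mul (by norm_num)]
      congr 1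
      rw [hδ_def]
      ring
    linarith
  · rw [typeI_tensorPow hρ.2]
    linarith [trace_mul_re_nonneg (hP n).1 (posSemidef_tensorPow hρ.1 n)]

/-- The direct part of the quantum Stein lemma, with type I errors bounded away from one. -/
lemma not_isStrongConverse_of_lt (hU : Uᴴ * U = 1) (hV : Vᴴ * V = 1) (hr0 : ∀ i, 0 ≤ r i)
    (hs0 : ∀ i, 0 ≤ s i) (hρ : IsState (conjDiag U r))
    (hsw : ∀ j, s j = 0 → diagWeight V (conjDiag U r) j = 0) {R : ℝ}
    (hR : R < ∑ i, r i * Real.logb 2 (r i) -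
      ∑ i, diagWeight V (conjDiag U r) i * Real.logb 2 (s i)) :
    ¬ IsStrongConverse (conjDiag U r) (conjDiag V s) R := by
  classical
  have hdw := diagWeight_conjDiag hU r
  have hr : ∑ i, r i = 1 := by simpa [hdw] using sum_diagWeight hU hρ.2
  have hw0 := diagWeight_nonneg hρ.1 V
  have hw1 := sum_diagWeight hV hρ.2
  set ρ := conjDiag U r with hρ_def
  set w := diagWeight V ρ with hw_def
  set μr := ∑ i, r i * Real.logb 2 (r i) with hμr
  set μs := ∑ i, w i * Real.logb 2 (s i) with hμs
  -- The rank exponent δ - μr and the eigenvalue exponent μs + δ then add up to -R.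
  set δ := (μr - μs - R) / 2 with hδ_def
  have hδ : 0 < δ := by linarith
  let S := typical r (fun i => Real.logb 2 (r i)) δ
  let T := typical w (fun i => Real.logb 2 (s i)) δ
  let F : (n : ℕ) → Matrix (Fin n → ι) (Fin n → ι) ℂ := fun n => proj (tensorPow U n) (S n)
  let E : (n : ℕ) → Matrix (Fin n → ι) (Fin n → ι) ℂ := fun n => proj (tensorPow V n) (T n)
  have hF : ∀ n, IsTest (F n) := fun n => isTest_proj (tensorPow_isometry hU n) _
  have hE : ∀ n, IsTest (E n) := fun n => isTest_proj (tensorPow_isometry hV n) _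
  have hEE : ∀ n, E n * E n = E n := fun n => proj_mul_self (tensorPow_isometry hV n) _
  refine not_isStrongConverse (c := 3 / 4) (by norm_num) (P := fun n => E n * F n * E n)
    (fun n => isTest_compression (hE n) (hEE n) (hF n)) (fun n => ?_) ?_
  · have hVn := tensorPow_isometry hV n
    have hle : ((2 : ℝ) ^ (n * (μs + δ)) • (1 : Matrix (Fin n → ι) (Fin n → ι) ℂ) -
        E n * tensorPow (conjDiag V s) n * E n).PosSemidef := by
      rw [← conjDiag_const hVn, tensorPow_conjDiag]
      simp only [E, proj]
      rw [conjDiag_mul hVn, conjDiag_mul hVn]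
      refine posSemidef_conjDiag_sub fun I => ?_
      by_cases hI : I ∈ T n
      · simpa [ind, hI] using (prod_mem_Icc_of_typical hs0 hsw hI).2
      · simp only [ind, hI, if_false, zero_mul]; positivity
    have h1 := trace_mul_re_mono_right (hF n).1 hle
    rw [Matrix.mul_smul, Matrix.mul_one, Matrix.trace_smul, Complex.smul_re, smul_eq_mul,
      trace_proj (tensorPow_isometry hU n)] at h1
    have h2 : typeII (E n * F n * E n) (tensorPow (conjDiag V s) n) =
        (F n * (E n * tensorPow (conjDiag V s) n * E n)).trace.re := by
      rw [typeII, Matrix.mul_assoc (E n), Matrix.mul_assoc (E n), Matrix.trace_mul_comm]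
      simp only [Matrix.mul_assoc]
    rw [h2]
    refine h1.trans ((mul_le_mul_of_nonneg_left (card_typical_le hr0 hr δ n)
      (by positivity)).trans (le_of_eq ?_))
    rw [← Real.rpow_add (by norm_num)]
    congr 1
    rw [hδ_def]
    ring
  · have hS := tendsto_sum_typical hr0 hr (fun i => Real.logb 2 (r i)) hδ
    have hT := tendsto_sum_typical hw0 hw1 (fun i => Real.logb 2 (s i)) hδ
    -- Pinching gives 7/8 < 2x + 2/8 for the success probability x of EFE, so x > 5/16 and the type
    -- I error is below 3/4.
    filter_upwards [hS.eventually_const_lt (show (7 / 8 : ℝ) < 1 by norm_num),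
      hT.eventually_const_lt (show (7 / 8 : ℝ) < 1 by norm_num)] with n hSn hTn
    have hρn := posSemidef_tensorPow hρ.1 n
    have h1 := trace_mul_re_pinching (hE n).1.isHermitian (hF n).1 hρn
    have h2 := trace_mul_re_mono_left hρn
      (posSemidef_sub_compl_compression (hE n).1.isHermitian (hEE n) (hF n))
    have h3 : ((1 - E n) * tensorPow ρ n).trace.re = 1 - ∑ I ∈ T n, ∏ k, w (I k) := by
      rw [← trace_proj_mul_tensorPow hρ.1]
      exact typeI_tensorPow hρ.2 _
    have h4 : (F n * tensorPow ρ n).trace.re = ∑ I ∈ S n, ∏ k, r (I k) := by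
      rw [trace_proj_mul_tensorPow hρ.1, hdw]
    rw [typeI_tensorPow hρ.2]
    linarith

end Rates

end QHT

end

theorem mainTheorem5 {ι : Type*} [Fintype ι] [DecidableEq ι] (ρ σ : Matrix ι ι ℂ)
    (hρ : QHT.IsState ρ) (hσ : QHT.IsState σ) :
    QHT.strongConverseRate ρ σ = QHT.relEntropy ρ σ ∧
      ∀ R : ℝ, QHT.relEntropy ρ σ < (R : EReal) → QHT.IsStrongConverse ρ σ R := by
  obtain ⟨U, r, hU, hr0, hρU, hcfcρ⟩ := QHT.exists_conjDiag hρ.1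
  obtain ⟨V, s, hV, hs0, hσV, hcfcσ⟩ := QHT.exists_conjDiag hσ.1
  have hsupp := QHT.supp_le_supp_conjDiag_iff (s := s) hρ.1 hV
  rw [← hσV] at hsupp
  by_cases h : QHT.supp ρ ≤ QHT.supp σ
  · have hsw := hsupp.mp h
    have hD : QHT.relEntropy ρ σ = ((∑ i, r i * Real.logb 2 (r i) -
        ∑ i, QHT.diagWeight V ρ i * Real.logb 2 (s i) : ℝ) : EReal) := by
      rw [QHT.relEntropy, if_pos h, hcfcρ, hcfcσ, Matrix.mul_sub, Matrix.trace_sub,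
        Complex.sub_re, QHT.trace_mul_conjDiag, QHT.trace_mul_conjDiag]
      congr 4
      rw [hρU, QHT.diagWeight_conjDiag hU]
    rw [hD]
    subst hρU hσV
    have hconv : ∀ R : ℝ, ((∑ i, r i * Real.logb 2 (r i) -
        ∑ i, QHT.diagWeight V (QHT.conjDiag U r) i * Real.logb 2 (s i) : ℝ) : EReal) < R →
        QHT.IsStrongConverse (QHT.conjDiag U r) (QHT.conjDiag V s) R := fun R hR =>
      QHT.isStrongConverse_of_lt hU hV hr0 hs0 hρ hsw (EReal.coe_lt_coe_iff.mp hR)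
    refine ⟨le_antisymm ?_ ?_, hconv⟩
    -- R = D itself is not claimed; reals above D suffice for the infimum.
    · refine EReal.le_of_forall_lt_iff_le.mp fun R hR => sInf_le ⟨R, hconv R hR, rfl⟩
    · refine le_sInf ?_
      rintro _ ⟨R, hR, rfl⟩
      refine EReal.coe_le_coe_iff.mpr (not_lt.mp fun hlt => ?_)
      exact QHT.not_isStrongConverse_of_lt hU hV hr0 hs0 hρ hsw hlt hR
  · have hD : QHT.relEntropy ρ σ = ⊤ := if_neg h
    rw [hsupp] at h
    push Not at h
    obtain ⟨j, hj, hw⟩ := h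
    rw [hD]
    refine ⟨?_, fun R hR => absurd hR not_top_lt⟩
    refine sInf_eq_top.mpr ?_
    rintro _ ⟨R, hR, rfl⟩
    subst hσV
    exact absurd hR (QHT.not_isStrongConverse_of_not_supp_le hρ hV hσ.1 hj hw R)
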